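/- **Theorem 1.3.** Let $k\ge 2$ be an integer. For a set $S\subseteq\mathbb{N}=\{0,1,2,\dots\}$ let $\pi_S(x)$ be the number of elements of $S$ that are less than $x$, and call $\liminf_{x\to\infty}\pi_S(x)/x$ and $\limsup_{x\to\infty}\pi_S(x)/x$ the lower density and the upper density of $S$. The set $S$ is called $k$-automatic if there is a deterministic finite automaton with output in $\{0,1\}$ that, for every $n\in\mathbb{N}$, on reading the base-$k$ expansion of $n$ from the most significant digit to the least significant one (the expansion of $0$ being the empty word), outputs $1$ if $n\in S$ and $0$ if $n\notin S$. 1. Let $(\alpha,\beta)$ be a pair of rational numbers satisfying either $0<\alpha\le\beta<1$ or $(\alpha,\beta)\in\{(0,0),(1,1)\}$. Then there is a $k$-automatic set $S$ whose lower density is $\alpha$ and whose upper density is $\beta$. 2. Conversely, if $S$ is a $k$-automatic set whose lower density is $\alpha$ and whose upper density is $\beta$, then either $(\alpha,\beta)\in\{(0,0),(1,1)\}$ or $\alpha,\beta$ are rational numbers with $0<\alpha\le\beta<1$. -/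

import Mathlib

/-- A deterministic finite automaton with output, with state set `Q`, input alphabet `A` and
output alphabet `Δ`. Finiteness of the state set is imposed where automata are used. -/
structure DFAO (Q A Δ : Type*) where
  /-- the transition function -/
  step : Q → A → Q
  /-- the initial state -/
  start : Q
  /-- the output function -/
  out : Q → Δ

/-- The output of the automaton on a word: start in the initial state, read the word from left to
right, and apply the output function to the state that is reached. -/
def DFAO.output {Q A Δ : Type*} (M : DFAO Q A Δ) (w : List A) : Δ :=
  M.out (w.foldl M.step M.start)

/-- The base-`k` expansion of `n` as a word over the alphabet `{0, …, k - 1}`, most significant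
digit first, without leading zeros; the expansion of `0` is the empty word.
(`Nat.digits` lists the least significant digit first.) -/
def baseExpansion {k : ℕ} (hk : 2 ≤ k) (n : ℕ) : List (Fin k) :=
  (Nat.digits k n).reverse.pmap Fin.mk
    (fun _ hd => Nat.digits_lt_base hk (List.mem_reverse.1 hd))

/-- A sequence is `k`-automatic if some automaton with finitely many states outputs its `n`-th term
on reading the base-`k` expansion of `n`, for every `n`. -/
def IsAutomaticSequence {k : ℕ} (hk : 2 ≤ k) {Δ : Type*} (a : ℕ → Δ) : Prop :=
  ∃ (Q : Type) (_ : Finite Q) (M : DFAO Q (Fin k) Δ), ∀ n, M.output (baseExpansion hk n) = a n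

/-- A set of natural numbers is `k`-automatic if its characteristic function, with values in
`{0, 1}`, is a `k`-automatic sequence. -/
def IsAutomaticSet {k : ℕ} (hk : 2 ≤ k) (S : Set ℕ) : Prop :=
  IsAutomaticSequence hk (S.indicator (1 : ℕ → Fin 2))

open Classical in
/-- The number of elements of `S` that are less than `x`. -/
noncomputable def countBelow (S : Set ℕ) (x : ℕ) : ℕ := Nat.count (· ∈ S) x

/-- The lower density of `S`. The quotients lie in `[0, 1]`, so the lower limit is a genuine one. -/
noncomputable def lowerDensity (S : Set ℕ) : ℝ :=
  Filter.liminf (fun x : ℕ => (countBelow S x : ℝ) / (x : ℝ)) Filter.atTop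

/-- The upper density of `S`. The quotients lie in `[0, 1]`, so the upper limit is a genuine one. -/
noncomputable def upperDensity (S : Set ℕ) : ℝ :=
  Filter.limsup (fun x : ℕ => (countBelow S x : ℝ) / (x : ℝ)) Filter.atTop

/-! For the converse direction, replace the base by a power `K` for which reading the digit zero is
an idempotent map on states, and let `P` average a function of the state over the `K` successors.
The proportion of accepted `L`-digit words from a state is `P ^ L` applied to the indicator of
`acc`. Idempotence forces `P ^ n (P u - u)` to tend to zero (`tendsto_norm_digitAvg_pow_sub`). Hence
the kernel and range of `P - 1` are complementary over `ℚ`, and the proportions converge to rational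
limits (`exists_tendsto_digitAvg_pow`).

Let `β` be the upper density. Scaled by the block length, the maximal excess of the count over `β x`
on a long block tends to a function `V` of the state solving a Bellman equation
(`exists_excess_bounds`). An optimal choice of digits turns this into a linear system, so `V = A - β
B` with `A`, `B` rational-valued. Since `β` is the upper density, the best excess over nonzero
leading digits is exactly zero. This is a linear equation for `β` with rational coefficients and
nonzero slope (`exists_rat_eq_upperDensity`). If the lower density is zero, the limiting proportion
from the initial state is zero, and monotonicity of the count makes the upper density zero.
Complementation transfers both facts to the other density.

For existence, let a set have local density `c₁` while the leading digit in base `K = k ^ p` is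
below `t`, and `c₀` otherwise. The ratio of count to `x` then oscillates between extremes near `K ^
L` and `t * K ^ L`, and `c₁`, `c₀` are solved for so that these are `α` and `β`
(`density_leadingDigitSet`). -/

open Filter Topology Finset

/-! ### Automata insensitive to leading zeros, and change of base -/

/-- A finite-state description of `S`: the state `r n` after reading `n` in base `k` is
insensitive to leading zeros and decides membership of `n`. -/
def Recognizable (k : ℕ) (S : Set ℕ) : Prop :=
  ∃ (Q : Type) (_ : Finite Q) (r : ℕ → Q) (δ : Q → ℕ → Q) (acc : Set Q),
    (∀ n d, d < k → r (k * n + d) = δ (r n) d) ∧ ∀ n, n ∈ S ↔ r n ∈ acc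

theorem baseExpansion_zero {k : ℕ} (hk : 2 ≤ k) : baseExpansion hk 0 = [] := by
  simp [baseExpansion]

theorem baseExpansion_mul_add {k : ℕ} (hk : 2 ≤ k) (n : ℕ) (d : Fin k)
    (h : 0 < k * n + d) :
    baseExpansion hk (k * n + d) = baseExpansion hk n ++ [d] := by
  have h1 : Nat.digits k (k * n + d) = (d : ℕ) :: Nat.digits k n := by
    rw [add_comm]
    refine Nat.digits_add k (by omega) d n d.2 ?_
    by_contra! hc
    simp [hc.1, hc.2] at h
  apply List.map_injective_iff.2 Fin.val_injective
  simp only [baseExpansion, List.map_append, List.map_pmap, List.map_cons, List.map_nil]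
  simp [h1]

theorem IsAutomaticSet.recognizable {k : ℕ} {hk : 2 ≤ k} {S : Set ℕ}
    (h : IsAutomaticSet hk S) : Recognizable k S := by
  classical
  obtain ⟨Q, hQ, M, hM⟩ := h
  let st (n : ℕ) : Q := (baseExpansion hk n).foldl M.step M.start
  have h0 : st 0 = M.start := by simp [st, baseExpansion_zero]
  let ex (d : ℕ) : Fin k := ⟨d % k, Nat.mod_lt _ (by omega)⟩
  -- The given automaton is constrained only on words without leading zeros; the extra state `none`
  -- absorbs zeros until the first nonzero digit.
  refine ⟨Option Q, inferInstance, fun n => if n = 0 then none else some (st n),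
    fun q d => match q with
      | none => if d = 0 then none else some (M.step M.start (ex d))
      | some q => some (M.step q (ex d)),
    {q | M.out (q.getD M.start) = 1}, ?_, ?_⟩
  · intro n d hd
    have hex : ((ex d : Fin k) : ℕ) = d := Nat.mod_eq_of_lt hd
    by_cases hp : 0 < k * n + d
    · have h1 : st (k * n + d) = M.step (st n) (ex d) := by
        have := baseExpansion_mul_add hk n (ex d) (by rwa [hex])
        rw [hex] at this
        simp [st, this]
      have hne : k * n + d ≠ 0 := by omega
      rcases Nat.eq_zero_or_pos n with rfl | hn
      · have hd0 : d ≠ 0 := by simpa using hne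
        simp only [if_neg hne, h1, h0]
        simp [hd0]
      · simp only [if_neg hne, h1]
        simp [hn.ne']
    · have : k * n = 0 ∧ d = 0 := by omega
      have hn : n = 0 := by
        rcases Nat.mul_eq_zero.1 this.1 with h | h <;> omega
      simp [hn, this.2]
  · intro n
    have hn : M.out (st n) = 1 ↔ n ∈ S := by
      have := hM n
      simp only [DFAO.output] at this
      rw [show M.out (st n) = _ from this]
      by_cases hS : n ∈ S <;> simp [hS]
    rw [← hn]
    by_cases h : n = 0
    · subst h; simp [h0]
    · simp [h]

theorem Recognizable.isAutomaticSet {k : ℕ} (hk : 2 ≤ k) {S : Set ℕ}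
    (h : Recognizable k S) : IsAutomaticSet hk S := by
  classical
  obtain ⟨Q, hQ, r, δ, acc, hr, hS⟩ := h
  refine ⟨Q, hQ, ⟨fun q d => δ q d, r 0, fun q => if q ∈ acc then 1 else 0⟩, fun n => ?_⟩
  have key : ∀ n, (baseExpansion hk n).foldl (fun q (d : Fin k) => δ q d) (r 0) = r n := by
    intro n
    induction n using Nat.strong_induction_on with
    | _ n ih =>
      rcases Nat.eq_zero_or_pos n with rfl | hn
      · simp [baseExpansion_zero]
      · have hd : n % k < k := Nat.mod_lt _ (by omega)
        have hdiv : k * (n / k) + n % k = n := Nat.div_add_mod n k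
        have h1 := baseExpansion_mul_add hk (n / k) ⟨n % k, hd⟩ (by simpa [hdiv] using hn)
        simp only [hdiv] at h1
        rw [h1, List.foldl_append, ih _ (Nat.div_lt_self hn (by omega))]
        simp only [List.foldl_cons, List.foldl_nil]
        rw [← hr _ _ hd, hdiv]
  simp only [DFAO.output, key]
  by_cases h : n ∈ S
  · simp [h, (hS n).1 h]
  · simp [h, mt (hS n).2 h]

/-- The new state remembers `r` at the `p` truncations `n / k ^ j` and the last `p` digits. A new
digit shifts this window, and the new value of `r` comes from the oldest truncation and the last `p`
digits. -/
theorem Recognizable.of_pow {k p : ℕ} (hk : 2 ≤ k) {S : Set ℕ}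
    (h : Recognizable (k ^ p) S) (hp : 0 < p) : Recognizable k S := by
  obtain ⟨Q, hQ, r, δ, acc, hr, hS⟩ := h
  have hkp : 0 < k ^ p := by positivity
  refine ⟨(Fin p → Q) × Fin (k ^ p), inferInstance,
    fun n => (fun j => r (n / k ^ (j : ℕ)), ⟨n % k ^ p, Nat.mod_lt _ hkp⟩),
    fun s d => (fun j => if hj : (j : ℕ) = 0 then
        δ (s.1 ⟨p - 1, by omega⟩) ((k * s.2 + d) % k ^ p)
        else s.1 ⟨j - 1, by omega⟩,
      ⟨(k * s.2 + d) % k ^ p, Nat.mod_lt _ hkp⟩),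
    {s | s.1 ⟨0, hp⟩ ∈ acc}, ?_, ?_⟩
  · intro n d hd
    have hmod : (k * (n % k ^ p) + d) % k ^ p = (k * n + d) % k ^ p := by
      simp [Nat.add_mod, Nat.mul_mod]
    have hdiv : ∀ j, (k * n + d) / k ^ (j + 1) = n / k ^ j := by
      intro j
      rw [pow_succ', ← Nat.div_div_eq_div_mul, Nat.mul_add_div (by omega),
        Nat.div_eq_of_lt hd, add_zero]
    ext j
    · dsimp only
      split_ifs with hj
      · rw [hj, hmod, pow_zero, Nat.div_one, ← hr _ _ (Nat.mod_lt _ hkp), ← hdiv (p - 1),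
          Nat.sub_add_cancel hp, Nat.div_add_mod]
      · obtain ⟨i, hi⟩ : ∃ i, (j : ℕ) = i + 1 := ⟨j - 1, by omega⟩
        simp only [hi, hdiv, Nat.add_sub_cancel]
    · simp [hmod]
  · intro n
    simp [hS]

/-- A finite self-map has an idempotent iterate. -/
theorem exists_iterate_idempotent {Q : Type*} [Finite Q] (z : Q → Q) :
    ∃ p, 0 < p ∧ ∀ q, z^[p] (z^[p] q) = z^[p] q := by
  have := Fintype.ofFinite Q
  -- The factorial is at least every preperiod and divisible by every period.
  refine ⟨(Fintype.card Q).factorial, Nat.factorial_pos _, fun q => ?_⟩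
  set N := (Fintype.card Q).factorial
  have hN : Fintype.card Q ≤ N := Nat.self_le_factorial _
  obtain ⟨i, j, hij, he⟩ : ∃ i j : Fin (Fintype.card Q + 1), i < j ∧ z^[i] q = z^[j] q := by
    obtain ⟨i, j, hne, he⟩ := Fintype.exists_ne_map_eq_of_card_lt
      (fun i : Fin (Fintype.card Q + 1) => z^[i] q) (by simp)
    rcases lt_or_gt_of_ne hne with h | h
    · exact ⟨i, j, h, he⟩
    · exact ⟨j, i, h, he.symm⟩
  have hij' : (i : ℕ) < j := hij
  have hper : Function.IsPeriodicPt z ((j : ℕ) - i) (z^[i] q) := by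
    rw [Function.IsPeriodicPt, Function.IsFixedPt, ← Function.iterate_add_apply,
      Nat.sub_add_cancel hij'.le, he]
  have hdvd : ((j : ℕ) - i) ∣ N := Nat.dvd_factorial (by omega) (by omega)
  have h2 : Function.IsPeriodicPt z N (z^[i] q) := hper.trans_dvd hdvd
  have h3 := h2.apply_iterate (N - i)
  rw [← Function.iterate_add_apply, Nat.sub_add_cancel (by omega)] at h3
  exact h3

/-- Passing to a power of the base, reading the digit zero becomes idempotent. -/
theorem Recognizable.exists_idempotent {k : ℕ} (hk : 2 ≤ k) {S : Set ℕ}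
    (h : Recognizable k S) : ∃ K, 2 ≤ K ∧
      ∃ (Q : Type) (_ : Finite Q) (r : ℕ → Q) (δ : Q → ℕ → Q) (acc : Set Q),
    (∀ n d, d < K → r (K * n + d) = δ (r n) d) ∧ (∀ n, n ∈ S ↔ r n ∈ acc) ∧
      ∀ q, δ (δ q 0) 0 = δ q 0 := by
  obtain ⟨Q, hQ, r, δ, acc, hr, hS⟩ := h
  obtain ⟨p, hp, hidem⟩ := exists_iterate_idempotent (fun q => δ q 0)
  have key : ∀ p, ∃ δ' : Q → ℕ → Q, (∀ n d, d < k ^ p → r (k ^ p * n + d) = δ' (r n) d) ∧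
      ∀ q, δ' q 0 = (fun q => δ q 0)^[p] q := by
    intro p
    induction p with
    | zero => exact ⟨fun q _ => q, fun n d hd => by simp [Nat.lt_one_iff.1 hd], by simp⟩
    | succ p ih =>
      obtain ⟨δ', h1, h2⟩ := ih
      refine ⟨fun q d => δ (δ' q (d / k)) (d % k), fun n d hd => ?_, fun q => ?_⟩
      · dsimp only
        rw [← h1 _ _ (Nat.div_lt_of_lt_mul (by rwa [pow_succ'] at hd)),
          ← hr _ _ (Nat.mod_lt _ (by omega)), mul_add, add_assoc, Nat.div_add_mod, pow_succ',
          mul_assoc]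
      · rw [Function.iterate_succ_apply']
        simp [h2]
  obtain ⟨δ', h1, h2⟩ := key p
  refine ⟨k ^ p, hk.trans (Nat.le_self_pow hp.ne' k), Q, hQ, r, δ', acc, h1, hS, fun q => ?_⟩
  rw [h2, h2, hidem]

theorem Recognizable.compl {k : ℕ} {S : Set ℕ} (h : Recognizable k S) : Recognizable k Sᶜ := by
  obtain ⟨Q, hQ, r, δ, acc, hr, hS⟩ := h
  exact ⟨Q, hQ, r, δ, accᶜ, hr, fun n => by simp [hS]⟩

/-! ### Counting functions and densities -/

theorem countBelow_le (S : Set ℕ) (x : ℕ) : countBelow S x ≤ x := by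
  classical
  unfold countBelow; exact Nat.count_le _

theorem countBelow_add_compl (S : Set ℕ) (x : ℕ) : countBelow S x + countBelow Sᶜ x = x := by
  simp only [countBelow]
  induction x with
  | zero => simp
  | succ n ih =>
    rw [Nat.count_succ, Nat.count_succ]
    by_cases h : n ∈ S
    · rw [if_pos h, if_neg (by simpa using h)]; omega
    · rw [if_neg h, if_pos (by simpa using h)]; omega

theorem countBelow_mono (S : Set ℕ) : Monotone (countBelow S) := by
  classical
  unfold countBelow; exact Nat.count_monotone _

theorem density_nonneg (S : Set ℕ) (x : ℕ) : 0 ≤ (countBelow S x : ℝ) / x := by positivity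

theorem density_le_one (S : Set ℕ) (x : ℕ) : (countBelow S x : ℝ) / x ≤ 1 :=
  div_le_one_of_le₀ (by exact_mod_cast countBelow_le S x) (by positivity)

theorem isBoundedUnder_le_density (S : Set ℕ) :
    IsBoundedUnder (· ≤ ·) atTop (fun x : ℕ => (countBelow S x : ℝ) / (x : ℝ)) :=
  isBoundedUnder_of ⟨1, density_le_one S⟩

theorem isBoundedUnder_ge_density (S : Set ℕ) :
    IsBoundedUnder (· ≥ ·) atTop (fun x : ℕ => (countBelow S x : ℝ) / (x : ℝ)) :=
  isBoundedUnder_of ⟨0, density_nonneg S⟩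

theorem lowerDensity_le_upperDensity (S : Set ℕ) : lowerDensity S ≤ upperDensity S :=
  liminf_le_limsup (isBoundedUnder_le_density S) (isBoundedUnder_ge_density S)

theorem upperDensity_le_of_eventually {S : Set ℕ} {b : ℝ}
    (h : ∀ᶠ x : ℕ in atTop, (countBelow S x : ℝ) ≤ b * x) : upperDensity S ≤ b := by
  refine limsup_le_of_le (isBoundedUnder_ge_density S).isCoboundedUnder_le ?_
  filter_upwards [h, eventually_gt_atTop 0] with x hx h0
  rwa [div_le_iff₀ (by exact_mod_cast h0)]

theorem le_upperDensity_of_frequently {S : Set ℕ} {b : ℝ}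
    (h : ∃ᶠ x : ℕ in atTop, b * x ≤ countBelow S x) : b ≤ upperDensity S := by
  refine le_limsup_of_frequently_le ?_ (isBoundedUnder_le_density S)
  refine (h.and_eventually (eventually_gt_atTop 0)).mono fun x hx => ?_
  rw [le_div_iff₀ (by exact_mod_cast hx.2)]
  exact hx.1

theorem upperDensity_compl (S : Set ℕ) : upperDensity Sᶜ = 1 - lowerDensity S := by
  have h : (fun x : ℕ => (countBelow Sᶜ x : ℝ) / (x : ℝ)) =ᶠ[atTop]
      fun x : ℕ => 1 - (countBelow S x : ℝ) / (x : ℝ) := by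
    filter_upwards [eventually_gt_atTop 0] with x hx
    have : (x : ℝ) ≠ 0 := by exact_mod_cast hx.ne'
    have h2 : (countBelow S x : ℝ) + countBelow Sᶜ x = x := by
      exact_mod_cast countBelow_add_compl S x
    field_simp
    linarith
  rw [upperDensity, limsup_congr h, lowerDensity]
  exact limsup_const_sub atTop _ 1 (isBoundedUnder_le_density S).isCoboundedUnder_ge
    (isBoundedUnder_ge_density S)

theorem lowerDensity_eq (S : Set ℕ) : lowerDensity S = 1 - upperDensity Sᶜ := by
  rw [upperDensity_compl]; ring

theorem lowerDensity_nonneg (S : Set ℕ) : 0 ≤ lowerDensity S :=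
  le_liminf_of_le (isBoundedUnder_le_density S).isCoboundedUnder_ge
    (Eventually.of_forall (density_nonneg S))

theorem le_lowerDensity_of_eventually {S : Set ℕ} {b : ℝ}
    (h : ∀ᶠ x : ℕ in atTop, b * x ≤ countBelow S x) : b ≤ lowerDensity S := by
  refine le_liminf_of_le (isBoundedUnder_le_density S).isCoboundedUnder_ge ?_
  filter_upwards [h, eventually_gt_atTop 0] with x hx h0
  rwa [le_div_iff₀ (by exact_mod_cast h0)]

theorem lowerDensity_le_of_frequently {S : Set ℕ} {b : ℝ}
    (h : ∃ᶠ x : ℕ in atTop, (countBelow S x : ℝ) ≤ b * x) : lowerDensity S ≤ b := by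
  refine liminf_le_of_frequently_le ?_ (isBoundedUnder_ge_density S)
  refine (h.and_eventually (eventually_gt_atTop 0)).mono fun x hx => ?_
  rw [div_le_iff₀ (by exact_mod_cast hx.2)]
  exact hx.1

/-! ### Averages over digit words and their convergence -/

/-- The averaging operator of an automaton: the mean of `f` over the successors of a state. -/
def digitAvg {Q : Type*} (K : ℕ) (δ : Q → ℕ → Q) (𝕜 : Type*) [Field 𝕜] :
    Module.End 𝕜 (Q → 𝕜) where
  toFun f q := (∑ d ∈ range K, f (δ q d)) / K
  map_add' f g := by ext q; simp [sum_add_distrib, add_div]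
  map_smul' c f := by ext q; simp [← mul_sum, mul_div_assoc]

theorem digitAvg_apply {Q : Type*} (K : ℕ) (δ : Q → ℕ → Q) {𝕜 : Type*} [Field 𝕜] (f : Q → 𝕜)
    (q : Q) : digitAvg K δ 𝕜 f q = (∑ d ∈ range K, f (δ q d)) / K := rfl

theorem digitAvg_pow_cast {Q : Type*} (K : ℕ) (δ : Q → ℕ → Q) (f : Q → ℚ) (n : ℕ) (q : Q) :
    (((digitAvg K δ ℚ ^ n) f q : ℚ) : ℝ) = (digitAvg K δ ℝ ^ n) (fun q => (f q : ℝ)) q := by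
  induction n generalizing q with
  | zero => simp
  | succ n ih =>
    rw [pow_succ', pow_succ', Module.End.mul_apply, Module.End.mul_apply, digitAvg_apply,
      digitAvg_apply]
    simp [ih]

section Convergence

variable {Q : Type*} {K : ℕ} {δ : Q → ℕ → Q}

theorem norm_digitAvg_le [Fintype Q] (f : Q → ℝ) : ‖digitAvg K δ ℝ f‖ ≤ ‖f‖ := by
  refine (pi_norm_le_iff_of_nonneg (norm_nonneg f)).2 fun q => ?_
  rw [digitAvg_apply, norm_div, Real.norm_natCast]
  refine div_le_of_le_mul₀ (by positivity) (norm_nonneg _) ?_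
  calc ‖∑ d ∈ range K, f (δ q d)‖ ≤ ∑ d ∈ range K, ‖f‖ :=
        norm_sum_le_of_le _ fun d _ => norm_le_pi_norm f _
    _ = ‖f‖ * K := by simp [mul_comm]

theorem norm_digitAvg_pow_le [Fintype Q] (f : Q → ℝ) (n : ℕ) :
    ‖(digitAvg K δ ℝ ^ n) f‖ ≤ ‖f‖ := by
  induction n with
  | zero => simp
  | succ n ih =>
    rw [pow_succ', Module.End.mul_apply]
    exact (norm_digitAvg_le _).trans ih

/-- If a mean of values at most `B` is at least `c`, the value at digit zero is not far below. -/
theorem le_apply_zero_of_le_digitAvg (hK : 1 ≤ K) {f : Q → ℝ} {B c : ℝ} (hB : ∀ q, f q ≤ B)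
    {q : Q} (hc : c ≤ digitAvg K δ ℝ f q) : K * c - (K - 1) * B ≤ f (δ q 0) := by
  have hK0 : (0 : ℝ) < K := by exact_mod_cast hK
  rw [digitAvg_apply, le_div_iff₀ hK0] at hc
  obtain ⟨m, rfl⟩ : ∃ m, K = m + 1 := ⟨K - 1, by omega⟩
  rw [sum_range_succ'] at hc
  have : ∑ d ∈ range m, f (δ q (d + 1)) ≤ ∑ d ∈ range m, B := sum_le_sum fun d _ => hB _
  simp only [sum_const, card_range, nsmul_eq_mul] at this
  push_cast at *
  linarith

theorem sum_digitAvg_pow_sub (u : Q → ℝ) (n N : ℕ) :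
    ∑ i ∈ range N, (digitAvg K δ ℝ ^ (n + i)) (digitAvg K δ ℝ u - u) =
      (digitAvg K δ ℝ ^ (n + N)) u - (digitAvg K δ ℝ ^ n) u := by
  induction N with
  | zero => simp
  | succ N ih =>
    rw [sum_range_succ, ih, map_sub, ← Module.End.mul_apply, ← pow_succ, ← add_assoc]
    abel

/-- A mean close to the upper bound of its terms forces the term at digit zero to be close too.
Idempotence keeps the state `δ q 0` fixed under further zeros, so `N` consecutive iterates are all
nearly `M` at this one state. Their sum telescopes to a difference of two iterates of `u`, hence is
at most `2 * ‖u‖`. -/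
theorem mul_le_of_le_digitAvg_pow [Fintype Q] (hK : 1 ≤ K)
    (hz : ∀ q, δ (δ q 0) 0 = δ q 0) (u : Q → ℝ) {M η : ℝ} (hη : 0 ≤ η) (n N : ℕ)
    (hB : ∀ m ≥ n, ‖(digitAvg K δ ℝ ^ m) (digitAvg K δ ℝ u - u)‖ ≤ M + η) (q : Q)
    (hq : M ≤ (digitAvg K δ ℝ ^ (n + N)) (digitAvg K δ ℝ u - u) q) :
    N * (M - K ^ N * η) ≤ 2 * ‖u‖ := by
  set P := digitAvg K δ ℝ
  set w := P u - u
  have hK' : (1 : ℝ) ≤ K := by exact_mod_cast hK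
  have hB' : ∀ m ≥ n, ∀ q, (P ^ m) w q ≤ M + η := fun m hm q =>
    (Real.le_norm_self _).trans ((norm_le_pi_norm _ q).trans (hB m hm))
  have key : ∀ j i, i + (j + 1) = N → M - (K ^ (j + 1) - 1) * η ≤ (P ^ (n + i)) w (δ q 0) := by
    intro j
    induction j with
    | zero =>
      intro i hi
      have h1 : M ≤ P ((P ^ (n + i)) w) q := by
        rwa [← Module.End.mul_apply, ← pow_succ', add_assoc, hi]
      have := le_apply_zero_of_le_digitAvg hK (hB' _ (by omega)) h1
      refine le_trans (le_of_eq ?_) this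
      ring
    | succ j ih =>
      intro i hi
      have h1 : M - (K ^ (j + 1) - 1) * η ≤ P ((P ^ (n + i)) w) (δ q 0) := by
        rw [← Module.End.mul_apply, ← pow_succ', add_assoc]
        exact ih (i + 1) (by omega)
      have := le_apply_zero_of_le_digitAvg hK (hB' _ (by omega)) h1
      rw [hz] at this
      refine le_trans (le_of_eq ?_) this
      ring
  have h1 : ∑ i ∈ range N, (M - K ^ N * η) ≤ ∑ i ∈ range N, (P ^ (n + i)) w (δ q 0) := by
    refine sum_le_sum fun i hi => ?_
    have hi' := mem_range.1 hi
    refine le_trans ?_ (key (N - 1 - i) i (by omega))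
    have : (K : ℝ) ^ (N - 1 - i + 1) ≤ K ^ N := pow_le_pow_right₀ hK' (by omega)
    nlinarith
  have h2 := congrFun (sum_digitAvg_pow_sub (K := K) (δ := δ) u n N) (δ q 0)
  rw [Finset.sum_apply] at h2
  rw [h2] at h1
  simp only [sum_const, card_range, nsmul_eq_mul] at h1
  refine h1.trans ?_
  refine (Real.le_norm_self _).trans ((norm_le_pi_norm _ _).trans ((norm_sub_le _ _).trans ?_))
  linarith [norm_digitAvg_pow_le (K := K) (δ := δ) u (n + N),
    norm_digitAvg_pow_le (K := K) (δ := δ) u n]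

/-- When the digit zero acts idempotently, the powers of the averaging operator are asymptotically
invariant. -/
theorem tendsto_norm_digitAvg_pow_sub [Fintype Q] [Nonempty Q] (hK : 1 ≤ K)
    (hz : ∀ q, δ (δ q 0) 0 = δ q 0) (u : Q → ℝ) :
    Tendsto (fun n => ‖(digitAvg K δ ℝ ^ n) (digitAvg K δ ℝ u - u)‖) atTop (𝓝 0) := by
  set P := digitAvg K δ ℝ
  set w := P u - u with hw
  have hanti : Antitone fun n => ‖(P ^ n) w‖ := antitone_nat_of_succ_le fun n => by
    rw [pow_succ', Module.End.mul_apply]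
    exact norm_digitAvg_le _
  have hbdd : BddBelow (Set.range fun n => ‖(P ^ n) w‖) := ⟨0, by rintro _ ⟨n, rfl⟩; simp⟩
  have hlim := tendsto_atTop_ciInf hanti hbdd
  set M := ⨅ n, ‖(P ^ n) w‖
  have hM0 : 0 ≤ M := le_ciInf fun n => norm_nonneg _
  suffices M = 0 by rwa [this] at hlim
  by_contra hne
  have hMpos : 0 < M := lt_of_le_of_ne hM0 (Ne.symm hne)
  -- First `N` is fixed with `N * M > 2 * ‖u‖ + 1`, then `η` so small that the loss `N * K ^ N * η`
  -- is at most 1; this contradicts `mul_le_of_le_digitAvg_pow`.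
  obtain ⟨N, hN⟩ := exists_nat_gt ((2 * ‖u‖ + 1) / M)
  rw [div_lt_iff₀ hMpos] at hN
  have hK0 : (0 : ℝ) < K := by exact_mod_cast hK
  obtain ⟨η, hη, hη2⟩ : ∃ η > 0, (N : ℝ) * (K ^ N * η) ≤ 1 := by
    refine ⟨1 / ((N + 1) * K ^ N), by positivity, ?_⟩
    rw [show (N : ℝ) * (K ^ N * (1 / ((N + 1) * K ^ N))) = N / (N + 1) by field_simp]
    rw [div_le_one (by positivity)]
    linarith
  obtain ⟨n, hn⟩ := (hlim.eventually (gt_mem_nhds (show M < M + η by linarith))).exists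
  have hB : ∀ m ≥ n, ‖(P ^ m) w‖ ≤ M + η := fun m hm => (hanti hm).trans hn.le
  obtain ⟨q, hq⟩ : ∃ q, ‖(P ^ (n + N)) w‖ = ‖(P ^ (n + N)) w q‖ := by
    obtain ⟨q, hq⟩ := Finite.exists_max fun q => ‖(P ^ (n + N)) w q‖
    exact ⟨q, le_antisymm ((pi_norm_le_iff_of_nonneg (norm_nonneg _)).2 hq)
      (norm_le_pi_norm _ q)⟩
  have hMq : M ≤ |(P ^ (n + N)) w q| := by
    rw [← Real.norm_eq_abs, ← hq]; exact ciInf_le hbdd _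
  have hfin : N * (M - K ^ N * η) ≤ 2 * ‖u‖ := by
    rcases le_abs.1 hMq with h | h
    · exact mul_le_of_le_digitAvg_pow hK hz u hη.le n N hB q h
    · have hneg : P (-u) - (-u) = -w := by rw [hw, map_neg]; abel
      have := mul_le_of_le_digitAvg_pow hK hz (-u) (M := M) hη.le n N
        (by change ∀ m ≥ n, ‖(P ^ m) (P (-u) - (-u))‖ ≤ _
            intro m hm
            rw [hneg, map_neg, norm_neg]
            exact hB m hm) q
        (by change _ ≤ (P ^ (n + N)) (P (-u) - (-u)) q
            rw [hneg, map_neg]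
            exact h)
      rwa [norm_neg] at this
  nlinarith

/-- The iterated means of a rational function converge to a rational function. -/
theorem exists_tendsto_digitAvg_pow [Finite Q] (hK : 1 ≤ K)
    (hz : ∀ q, δ (δ q 0) 0 = δ q 0) (f : Q → ℚ) :
    ∃ g : Q → ℚ, ∀ q,
      Tendsto (fun n => (((digitAvg K δ ℚ ^ n) f q : ℚ) : ℝ)) atTop (𝓝 (g q : ℝ)) := by
  cases isEmpty_or_nonempty Q
  · exact ⟨0, fun q => isEmptyElim q⟩
  have := Fintype.ofFinite Q
  set P := digitAvg K δ ℚ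
  have hlim : ∀ (u : Q → ℚ) q,
      Tendsto (fun n => (((P ^ n) ((P - 1) u) q : ℚ) : ℝ)) atTop (𝓝 0) := by
    intro u q
    have h1 := tendsto_norm_digitAvg_pow_sub hK hz (fun q => (u q : ℝ))
    have h2 : (fun n => (((P ^ n) ((P - 1) u) q : ℚ) : ℝ)) = fun n =>
        (digitAvg K δ ℝ ^ n) (digitAvg K δ ℝ (fun q => (u q : ℝ)) - fun q => (u q : ℝ)) q := by
      funext n
      rw [digitAvg_pow_cast]
      refine congrFun (congrArg _ ?_) q
      ext q
      simp [P, digitAvg_apply]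
    rw [h2]
    exact squeeze_zero_norm (fun n => norm_le_pi_norm _ q) h1
  have hfix : ∀ v, P v = v → ∀ n, (P ^ n) v = v := by
    intro v hv n
    induction n with
    | zero => simp
    | succ n ih => rw [pow_succ, Module.End.mul_apply, hv, ih]
  -- Powers of `P` fix the kernel and tend to zero on the range, so a common vector is zero;
  -- rank-nullity then makes the sum direct and total.
  have hdisj : Disjoint (LinearMap.ker (P - 1)) (LinearMap.range (P - 1)) := by
    rw [Submodule.disjoint_def]
    rintro v hv ⟨u, hu⟩
    have hPv : P v = v := by simpa [sub_eq_zero] using hv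
    ext q
    have h1 := hlim u q
    simp only [hu, hfix v hPv] at h1
    exact_mod_cast tendsto_nhds_unique tendsto_const_nhds h1
  have htop : LinearMap.ker (P - 1) ⊔ LinearMap.range (P - 1) = ⊤ := by
    refine Submodule.eq_top_of_disjoint _ _ ?_ hdisj
    rw [add_comm, LinearMap.finrank_range_add_finrank_ker]
  obtain ⟨v, hv, _, ⟨u, rfl⟩, hf⟩ := Submodule.mem_sup.1 (htop ▸ Submodule.mem_top : f ∈ _)
  have hPv : P v = v := by simpa [sub_eq_zero] using hv
  refine ⟨v, fun q => ?_⟩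
  have h2 : (fun n => (((P ^ n) f q : ℚ) : ℝ)) =
      fun n => (v q : ℝ) + (((P ^ n) ((P - 1) u) q : ℚ) : ℝ) := by
    funext n
    rw [← hf, map_add, hfix v hPv]
    push_cast [Pi.add_apply]
    rfl
  rw [h2]
  simpa using (hlim u q).const_add (v q : ℝ)

end Convergence

open Classical in
/-- The number of accepted `L`-digit words read from a state, in terms of iterated means. -/
theorem countBelow_block {Q : Type*} {K : ℕ} (hK : 1 ≤ K) {S : Set ℕ} {r : ℕ → Q}
    {δ : Q → ℕ → Q} {acc : Set Q} (hr : ∀ n d, d < K → r (K * n + d) = δ (r n) d)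
    (hS : ∀ n, n ∈ S ↔ r n ∈ acc) (L : ℕ) : ∀ m : ℕ,
    (countBelow S ((m + 1) * K ^ L) : ℚ) = countBelow S (m * K ^ L) +
      K ^ L * (digitAvg K δ ℚ ^ L) (acc.indicator 1) (r m) := by
  have hK0 : (K : ℚ) ≠ 0 := by exact_mod_cast (by omega : K ≠ 0)
  induction L with
  | zero =>
    intro m
    simp only [pow_zero, mul_one, countBelow, Nat.count_succ]
    by_cases h : m ∈ S
    · simp [h, (hS m).1 h]
    · simp [h, mt (hS m).2 h]
  | succ L ih =>
    intro m
    have key : ∀ D ≤ K, (countBelow S ((K * m + D) * K ^ L) : ℚ) =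
        countBelow S (m * K ^ (L + 1)) +
          ∑ d ∈ range D, K ^ L * (digitAvg K δ ℚ ^ L) (acc.indicator 1) (δ (r m) d) := by
      intro D
      induction D with
      | zero => intro _; simp [pow_succ, mul_assoc, mul_comm, mul_left_comm]
      | succ D ihD =>
        intro hD
        rw [← add_assoc, ih, hr _ _ (by omega), ihD (by omega), sum_range_succ, add_assoc]
    have := key K le_rfl
    rw [show (K * m + K) * K ^ L = (m + 1) * K ^ (L + 1) by ring] at this
    rw [this, pow_succ' (digitAvg K δ ℚ), Module.End.mul_apply, digitAvg_apply, ← mul_sum]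
    field_simp
    ring

/-! ### Discounted recursions on a finite state set -/

/-- The value function of a discounted deterministic decision process. -/
theorem exists_bellman {Q : Type*} [Finite Q] {K : ℕ} (hK : 2 ≤ K) (c : Q → ℕ → ℝ)
    (δ : Q → ℕ → Q) : ∃ V : Q → ℝ, (∀ q, ∀ d < K, c q d + V (δ q d) ≤ K * V q) ∧
      ∀ q, ∃ d < K, c q d + V (δ q d) = K * V q := by
  have := Fintype.ofFinite Q
  have hne : (range K).Nonempty := ⟨0, mem_range.2 (by omega)⟩
  have hK0 : (0 : ℝ) < K := by exact_mod_cast (by omega : 0 < K)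
  have hK2 : (2 : ℝ) ≤ K := by exact_mod_cast hK
  -- Division by `K ≥ 2` makes this operator a contraction in the sup norm; `V` is its fixed point.
  let T : (Q → ℝ) → Q → ℝ := fun V q => (range K).sup' hne fun d => (c q d + V (δ q d)) / K
  have hT : ∀ V W q, T V q ≤ T W q + 2⁻¹ * dist V W := by
    intro V W q
    refine Finset.sup'_le _ _ fun d hd => ?_
    have h1 : (c q d + W (δ q d)) / K ≤ T W q :=
      Finset.le_sup' (fun d => (c q d + W (δ q d)) / K) hd
    have h2 : V (δ q d) - W (δ q d) ≤ dist V W :=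
      (le_abs_self _).trans (dist_le_pi_dist V W (δ q d))
    have h3 : (c q d + V (δ q d)) / K ≤ (c q d + W (δ q d)) / K + dist V W / K := by
      rw [← add_div]
      exact div_le_div_of_nonneg_right (by linarith) hK0.le
    have h4 : dist V W / K ≤ dist V W / 2 := by gcongr
    linarith
  have hc : ContractingWith 2⁻¹ T := by
    refine ⟨by rw [← NNReal.coe_lt_coe]; norm_num, LipschitzWith.of_dist_le_mul fun V W => ?_⟩
    refine (dist_pi_le_iff (by positivity)).2 fun q => ?_
    rw [Real.dist_eq, abs_sub_le_iff]
    have h1 := hT V W q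
    have h2 := hT W V q
    rw [dist_comm W V] at h2
    push_cast
    constructor <;> linarith
  have hfix : T (hc.fixedPoint T) = hc.fixedPoint T := hc.fixedPoint_isFixedPt
  set V := hc.fixedPoint T
  refine ⟨V, fun q d hd => ?_, fun q => ?_⟩
  · have : (c q d + V (δ q d)) / K ≤ T V q :=
      Finset.le_sup' (fun d => (c q d + V (δ q d)) / K) (mem_range.2 hd)
    rw [hfix, div_le_iff₀ hK0] at this
    linarith
  · obtain ⟨d, hd, h⟩ := Finset.exists_mem_eq_sup' hne fun d => (c q d + V (δ q d)) / K
    refine ⟨d, mem_range.1 hd, ?_⟩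
    have h1 : V q = (c q d + V (δ q d)) / K := by rw [← h]; exact (congrFun hfix q).symm
    rw [h1]
    field_simp

/-- At a minimum `p` one has `W p ≤ W (τ p) ≤ K * W p`, so `W p` cannot be negative. -/
theorem nonneg_of_apply_le_mul {Q : Type*} [Finite Q] {K : ℕ} (hK : 2 ≤ K) {𝕜 : Type*} [Field 𝕜]
    [LinearOrder 𝕜] [IsStrictOrderedRing 𝕜] {τ : Q → Q} {W : Q → 𝕜}
    (h : ∀ q, W (τ q) ≤ K * W q) (q : Q) : 0 ≤ W q := by
  have : Nonempty Q := ⟨q⟩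
  obtain ⟨p, hp⟩ := Finite.exists_min W
  refine le_trans ?_ (hp q)
  have h1 := h p
  have h2 := hp (τ p)
  have hK2 : (2 : 𝕜) ≤ K := by exact_mod_cast hK
  by_contra! hneg
  nlinarith

theorem eq_zero_of_apply_eq_mul {Q : Type*} [Finite Q] {K : ℕ} (hK : 2 ≤ K) {𝕜 : Type*} [Field 𝕜]
    [LinearOrder 𝕜] [IsStrictOrderedRing 𝕜] {τ : Q → Q} {W : Q → 𝕜}
    (h : ∀ q, W (τ q) = K * W q) (q : Q) : W q = 0 := by
  refine le_antisymm ?_ (nonneg_of_apply_le_mul hK (fun q => (h q).le) q)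
  have := nonneg_of_apply_le_mul (τ := τ) (W := -W) hK (fun q => by simp [h q]) q
  simpa using this

/-- The linear system is injective by `eq_zero_of_apply_eq_mul`, hence solvable over `ℚ`; this is
where rationality of the discounted sums comes from. -/
theorem exists_discounted_sum {Q : Type*} [Finite Q] {K : ℕ} (hK : 2 ≤ K) (τ : Q → Q)
    (a : Q → ℚ) : ∃ A : Q → ℚ, ∀ q, K * A q = a q + A (τ q) := by
  let T : (Q → ℚ) →ₗ[ℚ] (Q → ℚ) := (K : ℚ) • LinearMap.id - LinearMap.funLeft ℚ ℚ τ
  have hT : ∀ A q, T A q = K * A q - A (τ q) := fun A q => by simp [T, LinearMap.funLeft_apply]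
  have hinj : Function.Injective T := by
    rw [← LinearMap.ker_eq_bot, LinearMap.ker_eq_bot']
    intro A hA
    ext q
    refine eq_zero_of_apply_eq_mul (τ := τ) hK (fun q => ?_) q
    have := congrFun hA q
    rw [hT] at this
    exact (sub_eq_zero.1 this).symm
  obtain ⟨A, hA⟩ := LinearMap.surjective_of_injective hinj a
  refine ⟨A, fun q => ?_⟩
  rw [← hA, hT]
  ring

/-- Once `e n < b / 4`, the quantity `a n - b / 2` is at least halved in each step, up to a smaller
value. -/
theorem tendsto_zero_of_contracting_recursion {K : ℕ} (hK : 2 ≤ K) {a e : ℕ → ℝ}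
    (ha : ∀ n, 0 ≤ a n) (he : Tendsto e atTop (𝓝 0)) (h : ∀ n, a (n + 1) = a n / K + e n) :
    Tendsto a atTop (𝓝 0) := by
  have hK2 : (2 : ℝ) ≤ K := by exact_mod_cast hK
  refine tendsto_order.2 ⟨fun b hb => Eventually.of_forall fun n => hb.trans_le (ha n),
    fun b hb => ?_⟩
  obtain ⟨N, hN⟩ := eventually_atTop.1 (he.eventually (gt_mem_nhds (show (0 : ℝ) < b / 4 by linarith)))
  have key : ∀ j, a (N + j) - b / 2 ≤ a N * (1 / 2) ^ j := by
    intro j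
    induction j with
    | zero => simp; linarith
    | succ j ih =>
      rw [← add_assoc, h, pow_succ]
      have h1 := hN (N + j) (by omega)
      have h2 : a (N + j) / K ≤ a (N + j) / 2 := by gcongr; exact ha _
      linarith
  have hlim : Tendsto (fun j : ℕ => a N * (1 / 2 : ℝ) ^ j) atTop (𝓝 0) := by
    simpa using (tendsto_pow_atTop_nhds_zero_of_lt_one (by norm_num)
      (by norm_num : (1 / 2 : ℝ) < 1)).const_mul (a N)
  obtain ⟨J, hJ⟩ := eventually_atTop.1
    (hlim.eventually (gt_mem_nhds (show (0 : ℝ) < b / 2 by linarith)))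
  refine eventually_atTop.2 ⟨N + J, fun n hn => ?_⟩
  have h1 := key (n - N)
  have h2 := hJ (n - N) (by omega)
  rw [Nat.add_sub_cancel' (by omega)] at h1
  linarith

theorem tendsto_natLog_atTop {K : ℕ} (hK : 2 ≤ K) : Tendsto (Nat.log K) atTop atTop :=
  tendsto_atTop.2 fun L => eventually_atTop.2 ⟨K ^ L, fun x hx =>
    Nat.le_log_of_pow_le (by omega) hx⟩

/-! ### Rationality of the upper density, and the case of lower density zero -/

section Density

variable {Q : Type*} {K : ℕ} {S : Set ℕ} {r : ℕ → Q} {δ : Q → ℕ → Q} {F : ℕ → Q → ℝ}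

theorem countBelow_mul_add (hr : ∀ n d, d < K → r (K * n + d) = δ (r n) d)
    (hF : ∀ L m, (countBelow S ((m + 1) * K ^ L) : ℝ) =
      countBelow S (m * K ^ L) + K ^ L * F L (r m)) (L m D : ℕ) (hD : D ≤ K) :
    (countBelow S ((K * m + D) * K ^ L) : ℝ) = countBelow S (m * K ^ (L + 1)) +
      K ^ L * ∑ d ∈ range D, F L (δ (r m) d) := by
  induction D with
  | zero => simp [pow_succ, mul_assoc, mul_comm, mul_left_comm]
  | succ D ih =>
    rw [← add_assoc, hF, hr _ _ (by omega), ih (by omega), sum_range_succ]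
    ring

theorem abs_sum_sub_sum_le {F g : Q → ℝ} {e : ℝ} (he : ∀ q, |F q - g q| ≤ e) (he0 : 0 ≤ e)
    (q : Q) {d : ℕ} (hd : d ≤ K) :
    |∑ i ∈ range d, F (δ q i) - ∑ i ∈ range d, g (δ q i)| ≤ K * e := by
  rw [← sum_sub_distrib]
  refine (abs_sum_le_sum_abs _ _).trans ?_
  calc ∑ i ∈ range d, |F (δ q i) - g (δ q i)| ≤ ∑ i ∈ range d, e := sum_le_sum fun i _ => he _
    _ = d * e := by simp
    _ ≤ K * e := by gcongr

/-- Up to an error `o(K ^ L)`, the largest excess of the counting function over `β x` on a block of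
length `K ^ L` is `K ^ L` times a function of the state, which solves a Bellman equation. -/
theorem exists_excess_bounds [Finite Q] (hK : 2 ≤ K)
    (hr : ∀ n d, d < K → r (K * n + d) = δ (r n) d)
    (hF : ∀ L m, (countBelow S ((m + 1) * K ^ L) : ℝ) =
      countBelow S (m * K ^ L) + K ^ L * F L (r m))
    {g : Q → ℝ} (hg : ∀ q, Tendsto (fun L => F L q) atTop (𝓝 (g q))) (β : ℝ) :
    ∃ (V : Q → ℝ) (a : ℕ → ℝ), Tendsto a atTop (𝓝 0) ∧
      (∀ q, ∃ d < K, ∑ i ∈ range d, g (δ q i) - β * d + V (δ q d) = K * V q) ∧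
      (∀ L m d y, d < K → y < K ^ L →
        (countBelow S ((K * m + d) * K ^ L + y) : ℝ) - countBelow S (m * K ^ (L + 1)) -
          β * (d * K ^ L + y) ≤
        K ^ L * (∑ i ∈ range d, g (δ (r m) i) - β * d + V (δ (r m) d) + a L)) ∧
      (∀ L m d, d < K → ∃ y < K ^ L,
        K ^ L * (∑ i ∈ range d, g (δ (r m) i) - β * d + V (δ (r m) d) - a L) ≤
        (countBelow S ((K * m + d) * K ^ L + y) : ℝ) - countBelow S (m * K ^ (L + 1)) -
          β * (d * K ^ L + y)) := by
  have := Fintype.ofFinite Q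
  obtain ⟨V, hV1, hV2⟩ := exists_bellman hK (fun q d => ∑ i ∈ range d, g (δ q i) - β * d) δ
  have hKpos : 0 < K := by omega
  have hK0 : (0 : ℝ) < K := by exact_mod_cast hKpos
  let e : ℕ → ℝ := fun L => ∑ q, |F L q - g q|
  have he : ∀ L q, |F L q - g q| ≤ e L := fun L q =>
    single_le_sum (f := fun q => |F L q - g q|) (fun q _ => abs_nonneg _) (mem_univ q)
  have he0 : ∀ L, 0 ≤ e L := fun L => sum_nonneg fun q _ => abs_nonneg _
  have helim : Tendsto e atTop (𝓝 0) := by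
    have : Tendsto e atTop (𝓝 (∑ q : Q, |g q - g q|)) :=
      tendsto_finsetSum _ fun q _ => ((hg q).sub_const (g q)).abs
    simpa using this
  -- This is the error relative to `K ^ L`. The initial value dominates `|V|`, as blocks of length
  -- one have excess zero; each further digit divides the old error by `K` and adds the deviation of
  -- `F` from `g`.
  let b : ℕ → ℝ := fun L => Nat.rec (∑ q, |V q|) (fun n x => x / K + e n) L
  have hb : ∀ n, b (n + 1) = b n / K + e n := fun n => rfl
  have hb0 : ∀ n, 0 ≤ b n := by
    intro n
    induction n with
    | zero => exact sum_nonneg fun q _ => abs_nonneg _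
    | succ n ih => rw [hb]; have := he0 n; positivity
  have hblim := tendsto_zero_of_contracting_recursion hK hb0 helim hb
  have hVb : ∀ q, |V q| ≤ b 0 := fun q =>
    single_le_sum (f := fun q => |V q|) (fun q _ => abs_nonneg _) (mem_univ q)
  have hstep : ∀ L m d, d < K → |(countBelow S ((K * m + d) * K ^ L) : ℝ) -
      countBelow S (m * K ^ (L + 1)) - K ^ L * ∑ i ∈ range d, g (δ (r m) i)| ≤
      K ^ L * (K * e L) := by
    intro L m d hd
    rw [countBelow_mul_add hr hF L m d hd.le, add_sub_cancel_left, ← mul_sub, abs_mul,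
      abs_of_nonneg (by positivity : (0 : ℝ) ≤ K ^ L)]
    gcongr
    exact abs_sum_sub_sum_le (he L) (he0 L) _ hd.le
  have hupper : ∀ L m y, y < K ^ L →
      (countBelow S (m * K ^ L + y) : ℝ) - countBelow S (m * K ^ L) - β * y ≤
        K ^ L * (V (r m) + b L) := by
    intro L
    induction L with
    | zero =>
      intro m y hy
      have : y = 0 := by simpa using hy
      subst this
      have := neg_le_of_abs_le (hVb (r m))
      simp
      linarith
    | succ L ih =>
      intro m y hy
      have hd : y / K ^ L < K := Nat.div_lt_of_lt_mul (by rwa [pow_succ] at hy)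
      have hyd := Nat.div_add_mod y (K ^ L)
      have h1 := ih (K * m + y / K ^ L) (y % K ^ L) (Nat.mod_lt _ (by positivity))
      have h2 := (abs_le.1 (hstep L m _ hd)).2
      have h3 := hV1 (r m) _ hd
      rw [hr _ _ hd] at h1
      have h4 : (K * m + y / K ^ L) * K ^ L + y % K ^ L = m * K ^ (L + 1) + y := by
        conv_rhs => rw [← hyd]
        ring
      rw [h4] at h1
      have h5 : (y : ℝ) = K ^ L * (y / K ^ L : ℕ) + (y % K ^ L : ℕ) := by exact_mod_cast hyd.symm
      have h6 : (K : ℝ) ^ (L + 1) * (V (r m) + b (L + 1)) =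
          K ^ L * (K * V (r m)) + K ^ L * (K * e L) + K ^ L * b L := by
        rw [hb]; field_simp; ring
      have h7 := mul_le_mul_of_nonneg_left h3 (by positivity : (0 : ℝ) ≤ K ^ L)
      rw [h6]
      conv_lhs => rw [h5]
      linarith
  have hlower : ∀ L m, ∃ y < K ^ L, K ^ L * (V (r m) - b L) ≤
      (countBelow S (m * K ^ L + y) : ℝ) - countBelow S (m * K ^ L) - β * y := by
    intro L
    induction L with
    | zero =>
      intro m
      have := le_of_abs_le (hVb (r m))
      refine ⟨0, by simp, ?_⟩
      simp
      linarith
    | succ L ih =>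
      intro m
      obtain ⟨d, hd, h3⟩ := hV2 (r m)
      obtain ⟨y, hy, h1⟩ := ih (K * m + d)
      refine ⟨d * K ^ L + y, ?_, ?_⟩
      · calc d * K ^ L + y < (d + 1) * K ^ L := by linarith
          _ ≤ K * K ^ L := Nat.mul_le_mul_right _ hd
          _ = K ^ (L + 1) := by ring
      · have h2 := (abs_le.1 (hstep L m _ hd)).1
        rw [hr _ _ hd] at h1
        have h4 : (K * m + d) * K ^ L + y = m * K ^ (L + 1) + (d * K ^ L + y) := by ring
        rw [h4] at h1
        have h6 : (K : ℝ) ^ (L + 1) * (V (r m) - b (L + 1)) =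
            K ^ L * (K * V (r m)) - K ^ L * (K * e L) - K ^ L * b L := by
          rw [hb]; field_simp; ring
        rw [h6, ← h3]
        push_cast
        linarith
  refine ⟨V, fun L => b L + K * e L, ?_, hV2, fun L m d y hd hy => ?_, fun L m d hd => ?_⟩
  · simpa using hblim.add (helim.const_mul (K : ℝ))
  · have h1 := hupper L (K * m + d) y hy
    have h2 := (abs_le.1 (hstep L m _ hd)).2
    rw [hr _ _ hd] at h1
    linarith
  · obtain ⟨y, hy, h1⟩ := hlower L (K * m + d)
    refine ⟨y, hy, ?_⟩
    have h2 := (abs_le.1 (hstep L m _ hd)).1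
    rw [hr _ _ hd] at h1
    linarith

theorem exists_rat_eq_upperDensity [Finite Q] (hK : 2 ≤ K)
    (hr : ∀ n d, d < K → r (K * n + d) = δ (r n) d)
    (hF : ∀ L m, (countBelow S ((m + 1) * K ^ L) : ℝ) =
      countBelow S (m * K ^ L) + K ^ L * F L (r m))
    {g : Q → ℚ} (hg : ∀ q, Tendsto (fun L => F L q) atTop (𝓝 (g q : ℝ))) :
    ∃ p : ℚ, (p : ℝ) = upperDensity S := by
  have hKpos : 0 < K := by omega
  have hK0 : (0 : ℝ) < K := by exact_mod_cast hKpos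
  set β := upperDensity S with hβ
  obtain ⟨V, a, ha, hV, hup, hlow⟩ := exists_excess_bounds hK hr hF hg β
  -- The limiting best excess among `x` with leading digit `d`, in units of `K ^ L`. The digit zero
  -- is left out of the maximum, since it does not force `x` to be large.
  let c : ℕ → ℝ := fun d => ∑ i ∈ range d, (g (δ (r 0) i) : ℝ) - β * d + V (δ (r 0) d)
  obtain ⟨D, hD, hmax⟩ := exists_max_image (Ico 1 K) c ⟨1, by simp; omega⟩
  rw [mem_Ico] at hD
  have hcount0 : countBelow S 0 = 0 := Nat.le_zero.1 (countBelow_le S 0)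
  have hle : c D ≤ 0 := by
    by_contra! hpos
    -- Half of `c D` absorbs the error `a L`, and the factor `K` comes from `x ≤ K * K ^ L`.
    have : β + c D / (2 * K) ≤ β := by
      refine le_upperDensity_of_frequently (frequently_atTop.2 fun X => ?_)
      obtain ⟨L, hL, hLX⟩ := ((ha.eventually (gt_mem_nhds (half_pos hpos))).and
        (eventually_ge_atTop X)).exists
      obtain ⟨y, hy, h⟩ := hlow L 0 D hD.2
      simp only [mul_zero, zero_add, zero_mul, hcount0, Nat.cast_zero, sub_zero] at h
      refine ⟨D * K ^ L + y, ?_, ?_⟩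
      · have h1 : L < K ^ L := Nat.lt_pow_self (by omega)
        have h2 : K ^ L ≤ D * K ^ L := Nat.le_mul_of_pos_left _ hD.1
        omega
      · have h1 : D * K ^ L + y ≤ K * K ^ L := by
          have := Nat.mul_le_mul_right (K ^ L) hD.2
          rw [Nat.succ_mul] at this
          omega
        have h1' : ((D : ℝ) * K ^ L + y) ≤ K * K ^ L := by exact_mod_cast h1
        have h2 : c D / (2 * K) * (D * K ^ L + y) ≤ c D / (2 * K) * (K * K ^ L) := by gcongr
        have h3 : c D / (2 * K) * (K * K ^ L) = K ^ L * (c D / 2) := by field_simp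
        have h4 : (K : ℝ) ^ L * (c D / 2) ≤ K ^ L * (c D - a L) := by
          gcongr; linarith
        have h5 := h4.trans h
        push_cast
        linarith
    have : 0 < c D / (2 * K) := by positivity
    linarith
  have hge : 0 ≤ c D := by
    by_contra! hneg
    have : β ≤ β + c D / (2 * K) := by
      refine upperDensity_le_of_eventually ?_
      filter_upwards [(tendsto_natLog_atTop hK).eventually
        (ha.eventually (gt_mem_nhds (show 0 < -(c D / 2) by linarith))),
        eventually_gt_atTop 0] with x hx hx0
      set L := Nat.log K x
      have h1 : K ^ L ≤ x := Nat.pow_log_le_self K hx0.ne'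
      have h2 : x < K ^ (L + 1) := Nat.lt_pow_succ_log_self (by omega) x
      have hd : x / K ^ L < K := Nat.div_lt_of_lt_mul (by rwa [pow_succ] at h2)
      have hd1 : 1 ≤ x / K ^ L := (Nat.one_le_div_iff (by positivity)).2 h1
      have h := hup L 0 _ (x % K ^ L) hd (Nat.mod_lt _ (by positivity))
      have h5 : (x : ℝ) = (x / K ^ L : ℕ) * K ^ L + (x % K ^ L : ℕ) := by
        exact_mod_cast (Nat.div_add_mod' x (K ^ L)).symm
      simp only [mul_zero, zero_add, zero_mul, hcount0, Nat.cast_zero, sub_zero, ← h5,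
        Nat.div_add_mod'] at h
      have h3 := hmax _ (mem_Ico.2 ⟨hd1, hd⟩)
      have h4 : (K : ℝ) ^ L * (c (x / K ^ L) + a L) ≤ K ^ L * (c D / 2) := by
        gcongr; linarith
      have h6 : (x : ℝ) ≤ K * K ^ L := by
        rw [← pow_succ']; exact_mod_cast h2.le
      have h7 : c D / (2 * K) * (K * K ^ L) = K ^ L * (c D / 2) := by field_simp
      have h8 : c D / (2 * K) * (K * K ^ L) ≤ c D / (2 * K) * x :=
        mul_le_mul_of_nonpos_left h6 (div_nonpos_of_nonpos_of_nonneg hneg.le (by positivity))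
      have h9 := h.trans h4
      linarith
    have : c D / (2 * K) < 0 := div_neg_of_neg_of_pos hneg (by positivity)
    linarith
  have hzero : c D = 0 := le_antisymm hle hge
  -- Along the optimal digits the Bellman equation is linear; `A` collects the discounted rational
  -- gains and `B` the discounted digits, the coefficient of `-β`.
  choose pol hpol hpolV using hV
  obtain ⟨A, hA⟩ := exists_discounted_sum hK (fun q => δ q (pol q))
    (fun q => ∑ i ∈ range (pol q), g (δ q i))
  obtain ⟨B, hB⟩ := exists_discounted_sum hK (fun q => δ q (pol q)) (fun q => (pol q : ℚ))
  have hB0 : ∀ q, 0 ≤ B q := nonneg_of_apply_le_mul (τ := fun q => δ q (pol q)) hK fun q => by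
    have : (0 : ℚ) ≤ pol q := by positivity
    linarith [hB q]
  have hVAB : ∀ q, V q = A q - β * B q := by
    intro q
    have := eq_zero_of_apply_eq_mul (τ := fun q => δ q (pol q))
      (W := fun q => V q - (A q - β * B q)) hK (fun q => by
        have h1 := hpolV q
        have h2 : (K : ℝ) * A q = ∑ i ∈ range (pol q), (g (δ q i) : ℝ) + A (δ q (pol q)) := by
          exact_mod_cast hA q
        have h3 : (K : ℝ) * B q = pol q + B (δ q (pol q)) := by exact_mod_cast hB q
        linear_combination h1 + h2 - β * h3) q
    linarith
  have hDB : (0 : ℝ) < D + B (δ (r 0) D) := by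
    have h1 : (1 : ℝ) ≤ D := by exact_mod_cast hD.1
    have h2 : (0 : ℝ) ≤ B (δ (r 0) D) := by exact_mod_cast hB0 _
    linarith
  refine ⟨(∑ i ∈ range D, g (δ (r 0) i) + A (δ (r 0) D)) / (D + B (δ (r 0) D)), ?_⟩
  push_cast
  rw [div_eq_iff hDB.ne']
  have h1 : ∑ i ∈ range D, (g (δ (r 0) i) : ℝ) - β * D + V (δ (r 0) D) = 0 := hzero
  rw [hVAB] at h1
  linarith

/-- The count at `K ^ L` is governed by the limit `g (r 0)`, and monotonicity compares any `x` with
neighbouring powers at the cost of a factor `K`. A positive limit would make the lower density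
positive; otherwise the upper density vanishes. -/
theorem upperDensity_eq_zero_of_lowerDensity_eq_zero (hK : 2 ≤ K)
    (hF : ∀ L m, (countBelow S ((m + 1) * K ^ L) : ℝ) =
      countBelow S (m * K ^ L) + K ^ L * F L (r m))
    {g : Q → ℝ} (hg : ∀ q, Tendsto (fun L => F L q) atTop (𝓝 (g q)))
    (h : lowerDensity S = 0) : upperDensity S = 0 := by
  have hKpos : 0 < K := by omega
  have hK0 : (0 : ℝ) < K := by exact_mod_cast hKpos
  have hcount0 : countBelow S 0 = 0 := Nat.le_zero.1 (countBelow_le S 0)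
  have hpow : ∀ L, (countBelow S (K ^ L) : ℝ) = K ^ L * F L (r 0) := fun L => by
    simpa [hcount0] using hF L 0
  have hup0 : 0 ≤ upperDensity S := h ▸ lowerDensity_le_upperDensity S
  have hg0 : g (r 0) ≤ 0 := by
    by_contra! hpos
    have : g (r 0) / (2 * K) ≤ lowerDensity S := by
      refine le_lowerDensity_of_eventually ?_
      filter_upwards [(tendsto_natLog_atTop hK).eventually
        ((hg (r 0)).eventually (lt_mem_nhds (half_lt_self hpos))),
        eventually_gt_atTop 0] with x hx hx0
      set L := Nat.log K x
      have h1 : K ^ L ≤ x := Nat.pow_log_le_self K hx0.ne'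
      have h2 : x < K ^ (L + 1) := Nat.lt_pow_succ_log_self (by omega) x
      have h3 : (countBelow S (K ^ L) : ℝ) ≤ countBelow S x := by
        exact_mod_cast countBelow_mono S h1
      rw [hpow] at h3
      have h6 : (x : ℝ) ≤ K * K ^ L := by
        rw [← pow_succ']; exact_mod_cast h2.le
      calc g (r 0) / (2 * K) * x ≤ g (r 0) / (2 * K) * (K * K ^ L) := by gcongr
        _ = K ^ L * (g (r 0) / 2) := by field_simp
        _ ≤ K ^ L * F L (r 0) := by gcongr
        _ ≤ _ := h3
    have : 0 < g (r 0) / (2 * K) := by positivity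
    linarith
  refine le_antisymm (le_of_forall_pos_le_add fun η hη => ?_) hup0
  rw [zero_add]
  refine upperDensity_le_of_eventually ?_
  filter_upwards [((tendsto_add_atTop_nat 1).comp (tendsto_natLog_atTop hK)).eventually
    ((hg (r 0)).eventually (gt_mem_nhds (hg0.trans_lt (show 0 < η / K by positivity)))),
    eventually_gt_atTop 0] with x hx hx0
  simp only [Function.comp] at hx
  set L := Nat.log K x
  have h1 : (K : ℝ) ^ L ≤ x := by exact_mod_cast Nat.pow_log_le_self K hx0.ne'
  have h2 : x < K ^ (L + 1) := Nat.lt_pow_succ_log_self (by omega) x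
  have h3 : (countBelow S x : ℝ) ≤ countBelow S (K ^ (L + 1)) := by
    exact_mod_cast countBelow_mono S h2.le
  rw [hpow] at h3
  calc (countBelow S x : ℝ) ≤ K ^ (L + 1) * F (L + 1) (r 0) := h3
    _ ≤ K ^ (L + 1) * (η / K) := by gcongr
    _ = η * K ^ L := by field_simp; ring
    _ ≤ η * x := by gcongr

end Density

/-! ### The possible pairs of densities -/

theorem Recognizable.rational_and_zero {k : ℕ} (hk : 2 ≤ k) {S : Set ℕ} (h : Recognizable k S) :
    (∃ p : ℚ, (p : ℝ) = upperDensity S) ∧ (lowerDensity S = 0 → upperDensity S = 0) := by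
  classical
  obtain ⟨K, hK, Q, hQ, r, δ, acc, hr, hS, hz⟩ := h.exists_idempotent hk
  obtain ⟨g, hg⟩ := exists_tendsto_digitAvg_pow (by omega : 1 ≤ K) hz (acc.indicator 1)
  have hF : ∀ L m, (countBelow S ((m + 1) * K ^ L) : ℝ) = countBelow S (m * K ^ L) +
      K ^ L * (((digitAvg K δ ℚ ^ L) (acc.indicator 1) (r m) : ℚ) : ℝ) := fun L m => by
    exact_mod_cast countBelow_block (by omega : 1 ≤ K) hr hS L m
  exact ⟨exists_rat_eq_upperDensity (F := fun L q => _) hK hr hF hg,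
    upperDensity_eq_zero_of_lowerDensity_eq_zero (F := fun L q => _) hK hF hg⟩

theorem Recognizable.density_cases {k : ℕ} (hk : 2 ≤ k) {S : Set ℕ} (h : Recognizable k S) :
    (lowerDensity S = 0 ∧ upperDensity S = 0) ∨ (lowerDensity S = 1 ∧ upperDensity S = 1) ∨
      ((∃ p : ℚ, (p : ℝ) = lowerDensity S) ∧ (∃ q : ℚ, (q : ℝ) = upperDensity S) ∧
        0 < lowerDensity S ∧ lowerDensity S ≤ upperDensity S ∧ upperDensity S < 1) := by
  obtain ⟨hrat, hzero⟩ := h.rational_and_zero hk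
  obtain ⟨⟨p, hp⟩, hzero'⟩ := h.compl.rational_and_zero hk
  have hl := lowerDensity_eq S
  have hl' := lowerDensity_eq Sᶜ
  rw [compl_compl] at hl'
  have hle := lowerDensity_le_upperDensity S
  have h0 := lowerDensity_nonneg S
  have h1 := lowerDensity_nonneg Sᶜ
  rcases h0.eq_or_lt with h | hpos
  · exact Or.inl ⟨h.symm, hzero h.symm⟩
  rcases h1.eq_or_lt with h | hpos'
  · have := hzero' h.symm
    exact Or.inr (Or.inl ⟨by linarith, by linarith⟩)
  · exact Or.inr (Or.inr ⟨⟨1 - p, by push_cast; linarith⟩, hrat, hpos, hle, by linarith⟩)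

/-! ### Counting residues modulo `b` -/

theorem countBelow_succ_of_mem {S : Set ℕ} {x : ℕ} (h : x ∈ S) :
    countBelow S (x + 1) = countBelow S x + 1 := by
  classical
  unfold countBelow
  rw [Nat.count_succ, if_pos h]

theorem countBelow_succ_of_notMem {S : Set ℕ} {x : ℕ} (h : x ∉ S) :
    countBelow S (x + 1) = countBelow S x := by
  classical
  unfold countBelow
  rw [Nat.count_succ, if_neg h, add_zero]

theorem countBelow_sub_congr {S R : Set ℕ} {x z : ℕ} (hxz : x ≤ z)
    (h : ∀ n, x ≤ n → n < z → (n ∈ S ↔ n ∈ R)) :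
    (countBelow S z : ℝ) - countBelow S x = countBelow R z - countBelow R x := by
  induction z, hxz using Nat.le_induction with
  | base => simp
  | succ z hxz ih =>
    have ih := ih fun n h1 h2 => h n h1 (by omega)
    by_cases hz : z ∈ S
    · rw [countBelow_succ_of_mem hz, countBelow_succ_of_mem ((h z hxz (by omega)).1 hz)]
      push_cast
      linarith
    · rw [countBelow_succ_of_notMem hz,
        countBelow_succ_of_notMem (mt (h z hxz (by omega)).2 hz)]
      linarith

theorem countBelow_mod_lt {a b : ℕ} (hab : a ≤ b) (m s : ℕ) (hs : s ≤ b) :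
    countBelow {n | n % b < a} (b * m + s) = m * a + min s a := by
  have hstep : ∀ m s, s ≤ b → countBelow {n | n % b < a} (b * m + s) =
      countBelow {n | n % b < a} (b * m) + min s a := by
    intro m s
    induction s with
    | zero => simp
    | succ s ih =>
      intro hs
      have hmod : (b * m + s) % b = s := by
        rw [Nat.mul_add_mod, Nat.mod_eq_of_lt (by omega)]
      rw [← add_assoc]
      by_cases h : s < a
      · rw [countBelow_succ_of_mem (by simpa [hmod] using h), ih (by omega)]
        omega
      · rw [countBelow_succ_of_notMem (by simpa [hmod] using h), ih (by omega)]
        omega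
  have hbase : ∀ m, countBelow {n | n % b < a} (b * m) = m * a := by
    intro m
    induction m with
    | zero => simpa using countBelow_le _ 0
    | succ m ih => rw [mul_add, mul_one, hstep m b le_rfl, ih, min_eq_right hab]; ring
  rw [hstep m s hs, hbase]

theorem abs_countBelow_mod_lt_sub_le {a b : ℕ} (hab : a ≤ b) (hb : 0 < b) (x : ℕ) :
    |(countBelow {n | n % b < a} x : ℝ) - a / b * x| ≤ b := by
  have h := countBelow_mod_lt hab (x / b) (x % b) (Nat.mod_lt x hb).le
  have hx := Nat.div_add_mod x b
  rw [hx] at h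
  have hb0 : (0 : ℝ) < b := by exact_mod_cast hb
  have hx' : (x : ℝ) = b * (x / b : ℕ) + (x % b : ℕ) := by exact_mod_cast hx.symm
  have hs : ((x % b : ℕ) : ℝ) ≤ b := by exact_mod_cast (Nat.mod_lt x hb).le
  have hs0 : (0 : ℝ) ≤ ((x % b : ℕ) : ℝ) := by positivity
  have hab' : (a : ℝ) / b ≤ 1 := div_le_one_of_le₀ (by exact_mod_cast hab) hb0.le
  have hab0 : (0 : ℝ) ≤ (a : ℝ) / b := by positivity
  have hmin : ((min (x % b) a : ℕ) : ℝ) ≤ b := by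
    exact_mod_cast (min_le_left _ _).trans (Nat.mod_lt x hb).le
  have hmin0 : (0 : ℝ) ≤ ((min (x % b) a : ℕ) : ℝ) := by positivity
  have key : (countBelow {n | n % b < a} x : ℝ) - a / b * x =
      (min (x % b) a : ℕ) - a / b * (x % b : ℕ) := by
    rw [h, hx']
    push_cast
    field_simp
    ring
  rw [key, abs_le]
  constructor <;> nlinarith

/-! ### Sets governed by the leading digit and a residue -/

/-- The leading digit of `n` in base `K`. -/
def leadingDigit (K n : ℕ) : ℕ := n / K ^ Nat.log K n

theorem leadingDigit_lt {K : ℕ} (hK : 2 ≤ K) (n : ℕ) : leadingDigit K n < K := by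
  refine Nat.div_lt_of_lt_mul ?_
  rw [← pow_succ]
  exact Nat.lt_pow_succ_log_self (by omega) n

theorem leadingDigit_eq_zero {K : ℕ} (hK : 2 ≤ K) {n : ℕ} : leadingDigit K n = 0 ↔ n = 0 := by
  refine ⟨fun h => ?_, fun h => by simp [h, leadingDigit]⟩
  by_contra hn
  have := (Nat.div_eq_zero_iff.1 h).resolve_left (by positivity)
  exact absurd (Nat.pow_log_le_self K hn) (by omega)

theorem leadingDigit_mul_add {K : ℕ} (hK : 2 ≤ K) {n d : ℕ} (hd : d < K) :
    leadingDigit K (K * n + d) = if leadingDigit K n = 0 then d else leadingDigit K n := by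
  simp only [leadingDigit_eq_zero hK]
  split_ifs with h
  · simp [h, leadingDigit, Nat.log_of_lt hd]
  · have h1 := Nat.pow_log_le_self K h
    have h2 := Nat.lt_pow_succ_log_self (by omega : 1 < K) n
    have hlog : Nat.log K (K * n + d) = Nat.log K n + 1 := by
      refine Nat.log_eq_of_pow_le_of_lt_pow ?_ ?_
      · rw [pow_succ']
        exact (Nat.mul_le_mul_left K h1).trans (Nat.le_add_right _ _)
      · calc K * n + d < K * (n + 1) := by rw [mul_add]; omega
          _ ≤ K * K ^ (Nat.log K n + 1) := Nat.mul_le_mul_left K h2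
          _ = _ := (pow_succ' _ _).symm
    rw [leadingDigit, hlog, pow_succ', ← Nat.div_div_eq_div_mul, Nat.mul_add_div (by omega),
      Nat.div_eq_of_lt hd, add_zero, leadingDigit]

/-- The set of `n` whose residue modulo `b` is less than `a₁` or `a₀`, according to whether the
leading digit of `n` in base `K` is less than `t` or not. -/
def leadingDigitSet (K t a₁ a₀ b : ℕ) : Set ℕ :=
  {n | n % b < if leadingDigit K n < t then a₁ else a₀}

theorem recognizable_leadingDigitSet {K t a₁ a₀ b : ℕ} (hK : 2 ≤ K) (hb : 0 < b) :
    Recognizable K (leadingDigitSet K t a₁ a₀ b) := by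
  refine ⟨Fin K × Fin b, inferInstance,
    fun n => (⟨leadingDigit K n, leadingDigit_lt hK n⟩, ⟨n % b, Nat.mod_lt _ hb⟩),
    fun s d => (if (s.1 : ℕ) = 0 then ⟨d % K, Nat.mod_lt _ (by omega)⟩ else s.1,
      ⟨(K * s.2 + d) % b, Nat.mod_lt _ hb⟩),
    {s | (s.2 : ℕ) < if (s.1 : ℕ) < t then a₁ else a₀}, fun n d hd => ?_, fun n => Iff.rfl⟩
  ext
  · simp only [leadingDigit_mul_add hK hd]
    split_ifs
    · exact (Nat.mod_eq_of_lt hd).symm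
    · rfl
  · simp [Nat.add_mod, Nat.mul_mod]

section LeadingDigitSet

variable {K t a₁ a₀ b : ℕ}

theorem abs_countBelow_sub_le {S : Set ℕ} {a x z : ℕ} (hab : a ≤ b) (hb : 0 < b) (hxz : x ≤ z)
    (h : ∀ n, x ≤ n → n < z → (n ∈ S ↔ n % b < a)) :
    |(countBelow S z : ℝ) - countBelow S x - a / b * (z - x)| ≤ 2 * b := by
  rw [countBelow_sub_congr (R := {n | n % b < a}) hxz h]
  have h1 := abs_le.1 (abs_countBelow_mod_lt_sub_le hab hb x)
  have h2 := abs_le.1 (abs_countBelow_mod_lt_sub_le hab hb z)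
  rw [abs_le]
  constructor <;> linarith [h1.1, h1.2, h2.1, h2.2]

theorem log_eq_of_mem_block {L n : ℕ} (h1 : K ^ L ≤ n) (h2 : n < K * K ^ L) : Nat.log K n = L :=
  Nat.log_eq_of_pow_le_of_lt_pow h1 (by rwa [pow_succ'])

theorem abs_countBelow_leadingDigitSet_low (ha : a₁ ≤ b) (hb : 0 < b) (htK : t < K) {L x : ℕ}
    (h1 : K ^ L ≤ x) (h2 : x ≤ t * K ^ L) :
    |(countBelow (leadingDigitSet K t a₁ a₀ b) x : ℝ) -
      countBelow (leadingDigitSet K t a₁ a₀ b) (K ^ L) - a₁ / b * (x - K ^ L)| ≤ 2 * b := by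
  have := abs_countBelow_sub_le (S := leadingDigitSet K t a₁ a₀ b) ha hb h1 fun n hn1 hn2 => by
    have hlog : Nat.log K n = L := log_eq_of_mem_block hn1
      ((hn2.trans_le h2).trans_le (Nat.mul_le_mul_right _ htK.le))
    have : leadingDigit K n < t := by
      rw [leadingDigit, hlog]
      exact Nat.div_lt_of_lt_mul (by rw [mul_comm]; omega)
    simp [leadingDigitSet, this]
  exact_mod_cast this

theorem abs_countBelow_leadingDigitSet_high (ha : a₀ ≤ b) (hb : 0 < b) (ht : 1 ≤ t) {L x : ℕ}
    (h1 : t * K ^ L ≤ x) (h2 : x ≤ K * K ^ L) :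
    |(countBelow (leadingDigitSet K t a₁ a₀ b) x : ℝ) -
      countBelow (leadingDigitSet K t a₁ a₀ b) (t * K ^ L) - a₀ / b * (x - t * K ^ L)| ≤
      2 * b := by
  have := abs_countBelow_sub_le (S := leadingDigitSet K t a₁ a₀ b) ha hb h1 fun n hn1 hn2 => by
    have hlog : Nat.log K n = L := log_eq_of_mem_block
      ((Nat.le_mul_of_pos_left _ ht).trans hn1) (by omega)
    have hpos : 0 < K ^ L := by
      rcases Nat.eq_zero_or_pos (K ^ L) with h | h
      · rw [h] at h2; omega
      · exact h
    have : ¬ leadingDigit K n < t := by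
      rw [leadingDigit, hlog, not_lt, Nat.le_div_iff_mul_le hpos]
      exact hn1
    simp [leadingDigitSet, this]
  exact_mod_cast this

/-- The count is piecewise linear up to a bounded error on each piece. `h₁` carries the value `α * K
^ L` at `K ^ L` to `β * t * K ^ L` at `t * K ^ L`, and `h₀` carries this to `α * K ^ (L + 1)`, so
the pattern repeats at every scale. -/
theorem density_leadingDigitSet (ht : 2 ≤ t) (htK : t < K) (hb : 0 < b) (ha₁ : a₁ ≤ b)
    (ha₀ : a₀ ≤ b) {α β : ℝ} (hα0 : 0 ≤ α) (hαβ : α ≤ β) (hβ1 : β ≤ 1)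
    (h₁ : α + a₁ / b * (t - 1) = β * t) (h₀ : β * t + a₀ / b * (K - t) = K * α) :
    lowerDensity (leadingDigitSet K t a₁ a₀ b) = α ∧
      upperDensity (leadingDigitSet K t a₁ a₀ b) = β := by
  set S := leadingDigitSet K t a₁ a₀ b
  set c₁ : ℝ := a₁ / b
  set c₀ : ℝ := a₀ / b
  have hK : 2 ≤ K := by omega
  have hb0 : (0 : ℝ) < b := by exact_mod_cast hb
  have ht2 : (2 : ℝ) ≤ t := by exact_mod_cast ht
  have htK' : (t : ℝ) < K := by exact_mod_cast htK
  have hc₁ : α ≤ c₁ := by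
    by_contra! h
    nlinarith
  have hc₀ : c₀ ≤ β := by
    by_contra! h
    nlinarith
  have hpow : ∀ L : ℕ, (0 : ℝ) < K ^ L := fun L => by
    have : (0 : ℝ) < K := by linarith
    positivity
  have hpow1 : ∀ L : ℕ, K ^ L ≤ t * K ^ L := fun L => Nat.le_mul_of_pos_left _ (by omega)
  have hpow2 : ∀ L : ℕ, t * K ^ L ≤ K * K ^ L := fun L => Nat.mul_le_mul_right _ htK.le
  have hmid : ∀ L e, |(countBelow S (K ^ L) : ℝ) - α * K ^ L| ≤ e →
      |(countBelow S (t * K ^ L) : ℝ) - β * t * K ^ L| ≤ e + 2 * b := by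
    intro L e he
    have h := abs_le.1 (abs_countBelow_leadingDigitSet_low (a₀ := a₀) ha₁ hb htK
      (hpow1 L) le_rfl)
    have he := abs_le.1 he
    have hx : c₁ * ((t * K ^ L : ℕ) - K ^ L) = (β * t - α) * K ^ L := by
      push_cast; linear_combination (K : ℝ) ^ L * h₁
    rw [hx] at h
    rw [abs_le]
    constructor <;> linarith [h.1, h.2, he.1, he.2]
  -- Each scale adds `2 * b` for each of its two pieces; the total is linear in `L`, hence
  -- negligible against `K ^ L`.
  have hpt : ∀ L : ℕ, |(countBelow S (K ^ L) : ℝ) - α * K ^ L| ≤ 4 * b * L + 1 := by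
    intro L
    induction L with
    | zero =>
      have h1 : (countBelow S 1 : ℝ) ≤ 1 := by exact_mod_cast countBelow_le S 1
      have h2 : (0 : ℝ) ≤ countBelow S 1 := by positivity
      rw [abs_le]
      simp only [pow_zero]
      constructor <;> simp <;> linarith
    | succ L ih =>
      have h := abs_le.1 (abs_countBelow_leadingDigitSet_high (a₁ := a₁) ha₀ hb
        (by omega : 1 ≤ t) (hpow2 L) le_rfl)
      have he := abs_le.1 (hmid L _ ih)
      have hx : c₀ * ((K * K ^ L : ℕ) - t * K ^ L) = (K * α - β * t) * K ^ L := by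
        push_cast; linear_combination (K : ℝ) ^ L * h₀
      rw [hx] at h
      rw [pow_succ', pow_succ', abs_le]
      push_cast
      constructor <;> linarith [h.1, h.2, he.1, he.2]
  have hbound : ∀ x : ℕ, 0 < x →
      α * x - (4 * b * Nat.log K x + 1 + 4 * b) ≤ countBelow S x ∧
        (countBelow S x : ℝ) ≤ β * x + (4 * b * Nat.log K x + 1 + 4 * b) := by
    intro x hx
    set L := Nat.log K x
    have hx1 : K ^ L ≤ x := Nat.pow_log_le_self K hx.ne'
    have hx2 : x < K * K ^ L := by
      rw [← pow_succ']; exact Nat.lt_pow_succ_log_self (by omega) x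
    have hx1' : (K : ℝ) ^ L ≤ x := by exact_mod_cast hx1
    have hx2' : (x : ℝ) ≤ K * K ^ L := by exact_mod_cast hx2.le
    rcases le_total x (t * K ^ L) with hxt | hxt
    · have hxt' : (x : ℝ) ≤ t * K ^ L := by exact_mod_cast hxt
      have h := abs_le.1 (abs_countBelow_leadingDigitSet_low (a₀ := a₀) ha₁ hb htK hx1 hxt)
      have he := abs_le.1 (hpt L)
      have hlow : α * (x - K ^ L) ≤ c₁ * (x - K ^ L) :=
        mul_le_mul_of_nonneg_right hc₁ (by linarith)
      -- Both sides are linear in `x` and agree at `t * K ^ L` by `h₁`; before that point the gap is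
      -- a nonnegative multiple of `β - α`.
      have hup : α * K ^ L + c₁ * (x - K ^ L) ≤ β * x := by
        have h3 : (t - 1) * (β * x - (α * K ^ L + c₁ * (x - K ^ L))) =
            (β - α) * (t * K ^ L - x) := by
          linear_combination (-(x - (K : ℝ) ^ L)) * h₁
        have h4 : 0 ≤ (β - α) * (t * K ^ L - x) :=
          mul_nonneg (by linarith) (by linarith)
        rw [← h3] at h4
        linarith [nonneg_of_mul_nonneg_right h4 (by linarith)]
      constructor <;> linarith [h.1, h.2, he.1, he.2]
    · have hxt' : (t : ℝ) * K ^ L ≤ x := by exact_mod_cast hxt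
      have h := abs_le.1 (abs_countBelow_leadingDigitSet_high (a₁ := a₁) ha₀ hb
        (by omega : 1 ≤ t) hxt hx2.le)
      have he := abs_le.1 (hmid L _ (hpt L))
      have hup : c₀ * (x - t * K ^ L) ≤ β * (x - t * K ^ L) :=
        mul_le_mul_of_nonneg_right hc₀ (by linarith)
      have hlow : α * x ≤ β * t * K ^ L + c₀ * (x - t * K ^ L) := by
        have h3 : (K - t) * ((β * t * K ^ L + c₀ * (x - t * K ^ L)) - α * x) =
            t * (β - α) * (K * K ^ L - x) := by
          linear_combination (x - t * (K : ℝ) ^ L) * h₀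
        have h4 : 0 ≤ t * (β - α) * (K * K ^ L - x) :=
          mul_nonneg (mul_nonneg (by linarith) (by linarith)) (by linarith)
        rw [← h3] at h4
        linarith [nonneg_of_mul_nonneg_right h4 (by linarith)]
      constructor <;> linarith [h.1, h.2, he.1, he.2]
  have herr : ∀ η > 0, ∀ᶠ L : ℕ in atTop, 4 * b * (L : ℝ) + 1 + 4 * b ≤ η * K ^ L := by
    intro η hη
    have hK1 : (1 : ℝ) < K := by linarith
    have h1 : Tendsto (fun L : ℕ => 4 * b * ((L : ℝ) ^ 1 / (K : ℝ) ^ L) +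
        (1 + 4 * b) * ((L : ℝ) ^ 0 / (K : ℝ) ^ L)) atTop (𝓝 (4 * (b : ℝ) * 0 + (1 + 4 * (b : ℝ)) * 0)) :=
      ((tendsto_pow_const_div_const_pow_of_one_lt 1 hK1).const_mul _).add
        ((tendsto_pow_const_div_const_pow_of_one_lt 0 hK1).const_mul _)
    filter_upwards [h1.eventually (gt_mem_nhds (by simpa using hη))] with L hL
    have h2 : 4 * b * ((L : ℝ) ^ 1 / (K : ℝ) ^ L) + (1 + 4 * b) * ((L : ℝ) ^ 0 / (K : ℝ) ^ L) =
        (4 * b * (L : ℝ) + 1 + 4 * b) / K ^ L := by ring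
    rw [h2, div_lt_iff₀ (hpow L)] at hL
    exact hL.le
  have hlarge : ∀ X L, X ≤ L → X ≤ K ^ L := fun X L h =>
    h.trans (Nat.lt_pow_self (by omega)).le
  refine ⟨le_antisymm ?_ ?_, le_antisymm ?_ ?_⟩
  · refine le_of_forall_pos_le_add fun η hη => ?_
    refine lowerDensity_le_of_frequently (frequently_atTop.2 fun X => ?_)
    obtain ⟨L, hL, hX⟩ := ((herr η hη).and (eventually_ge_atTop X)).exists
    refine ⟨K ^ L, hlarge X L hX, ?_⟩
    have := (abs_le.1 (hpt L)).2
    push_cast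
    linarith
  · refine le_of_forall_pos_sub_le fun η hη => ?_
    refine le_lowerDensity_of_eventually ?_
    filter_upwards [(tendsto_natLog_atTop hK).eventually (herr η hη),
      eventually_gt_atTop 0] with x hx hx0
    have h1 : (K : ℝ) ^ Nat.log K x ≤ x := by exact_mod_cast Nat.pow_log_le_self K hx0.ne'
    have h2 := mul_le_mul_of_nonneg_left h1 hη.le
    linarith [(hbound x hx0).1]
  · refine le_of_forall_pos_le_add fun η hη => ?_
    refine upperDensity_le_of_eventually ?_
    filter_upwards [(tendsto_natLog_atTop hK).eventually (herr η hη),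
      eventually_gt_atTop 0] with x hx hx0
    have h1 : (K : ℝ) ^ Nat.log K x ≤ x := by exact_mod_cast Nat.pow_log_le_self K hx0.ne'
    have h2 := mul_le_mul_of_nonneg_left h1 hη.le
    linarith [(hbound x hx0).2]
  · refine le_of_forall_pos_sub_le fun η hη => ?_
    refine le_upperDensity_of_frequently (frequently_atTop.2 fun X => ?_)
    obtain ⟨L, hL, hX⟩ := ((herr η hη).and (eventually_ge_atTop X)).exists
    refine ⟨t * K ^ L, (hlarge X L hX).trans (hpow1 L), ?_⟩
    have h1 := (abs_le.1 (hmid L _ (hpt L))).1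
    have h2 : η * K ^ L ≤ η * (t * K ^ L) := by
      gcongr
      exact le_mul_of_one_le_left (hpow L).le (by linarith)
    push_cast
    linarith

end LeadingDigitSet

/-! ### Realising a prescribed pair of densities -/

theorem exists_common_denominator {c₁ c₀ : ℚ} (h₁ : 0 ≤ c₁) (h₁' : c₁ ≤ 1) (h₀ : 0 ≤ c₀)
    (h₀' : c₀ ≤ 1) : ∃ a₁ a₀ b : ℕ, 0 < b ∧ a₁ ≤ b ∧ a₀ ≤ b ∧ c₁ = a₁ / b ∧ c₀ = a₀ / b := by
  have key : ∀ c : ℚ, 0 ≤ c → c = (c.num.toNat : ℚ) / c.den := fun c hc => by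
    have h : ((c.num.toNat : ℤ) : ℚ) = c.num := by
      rw [Int.toNat_of_nonneg (Rat.num_nonneg.2 hc)]
    conv_lhs => rw [← Rat.num_div_den c, ← h, Int.cast_natCast]
  have hb : 0 < c₁.den * c₀.den := Nat.mul_pos c₁.pos c₀.pos
  have hd₁ : (c₁.den : ℚ) ≠ 0 := by exact_mod_cast c₁.pos.ne'
  have hd₀ : (c₀.den : ℚ) ≠ 0 := by exact_mod_cast c₀.pos.ne'
  have e₁ : c₁ = ((c₁.num.toNat * c₀.den : ℕ) : ℚ) / (c₁.den * c₀.den : ℕ) := by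
    push_cast
    rw [mul_div_mul_right _ _ hd₀, ← key c₁ h₁]
  have e₀ : c₀ = ((c₀.num.toNat * c₁.den : ℕ) : ℚ) / (c₁.den * c₀.den : ℕ) := by
    push_cast
    rw [mul_comm (c₁.den : ℚ), mul_div_mul_right _ _ hd₁, ← key c₀ h₀]
  have hb' : (0 : ℚ) < (c₁.den * c₀.den : ℕ) := by exact_mod_cast hb
  refine ⟨_, _, _, hb, ?_, ?_, e₁, e₀⟩
  · rw [e₁, div_le_one hb'] at h₁'
    exact_mod_cast h₁'
  · rw [e₀, div_le_one hb'] at h₀'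
    exact_mod_cast h₀'

theorem exists_recognizable_of_density {k : ℕ} (hk : 2 ≤ k) {α β : ℚ} (hα : 0 < α) (hαβ : α ≤ β)
    (hβ : β < 1) : ∃ S, Recognizable k S ∧ lowerDensity S = α ∧ upperDensity S = β := by
  -- The inequality says that the local density `(β * t - α) / (t - 1)` is at most 1; a suitable `t`
  -- exists because `β < 1`.
  obtain ⟨t, ht, htα⟩ : ∃ t : ℕ, 2 ≤ t ∧ 1 - α ≤ t * (1 - β) := by
    obtain ⟨n, hn⟩ := exists_nat_gt ((1 - α) / (1 - β))
    rw [div_lt_iff₀ (by linarith)] at hn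
    refine ⟨n + 2, by omega, ?_⟩
    push_cast
    linarith
  -- The last inequality makes `(K * α - β * t) / (K - t)` nonnegative; `α > 0` allows it for a
  -- large power of `k`.
  obtain ⟨p, hp, htp, hpα⟩ : ∃ p : ℕ, 0 < p ∧ t < k ^ p ∧ t * β ≤ (k ^ p : ℕ) * α := by
    obtain ⟨n, hn⟩ := exists_nat_gt (t * β / α)
    rw [div_lt_iff₀ hα] at hn
    have h : n + t + 1 < k ^ (n + t + 1) := Nat.lt_pow_self (by omega)
    refine ⟨n + t + 1, by omega, by omega, hn.le.trans ?_⟩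
    have : (n : ℚ) ≤ (k ^ (n + t + 1) : ℕ) := by exact_mod_cast (by omega)
    exact mul_le_mul_of_nonneg_right this hα.le
  set K := k ^ p
  have ht2 : (2 : ℚ) ≤ t := by exact_mod_cast ht
  have htK : (t : ℚ) < K := by exact_mod_cast htp
  have h1 : (0 : ℚ) < t - 1 := by linarith
  have h2 : (0 : ℚ) < K - t := by linarith
  obtain ⟨a₁, a₀, b, hb, ha₁, ha₀, e₁, e₀⟩ :=
    exists_common_denominator (c₁ := (β * t - α) / (t - 1)) (c₀ := (K * α - β * t) / (K - t))
      (div_nonneg (by nlinarith) h1.le) ((div_le_one h1).2 (by linarith))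
      (div_nonneg (by linarith) h2.le) ((div_le_one h2).2 (by nlinarith))
  rw [div_eq_iff h1.ne'] at e₁
  rw [div_eq_iff h2.ne'] at e₀
  have hd := density_leadingDigitSet (α := (α : ℝ)) (β := (β : ℝ)) ht htp hb ha₁ ha₀
    (by exact_mod_cast hα.le) (by exact_mod_cast hαβ) (by exact_mod_cast hβ.le)
    (by have := congrArg (Rat.cast : ℚ → ℝ) e₁; push_cast at this; linarith)
    (by have := congrArg (Rat.cast : ℚ → ℝ) e₀; push_cast [K] at this ⊢; linarith)
  exact ⟨_, (recognizable_leadingDigitSet (by omega) hb).of_pow hk hp, hd⟩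

theorem recognizable_empty (k : ℕ) : Recognizable k ∅ :=
  ⟨Unit, inferInstance, fun _ => (), fun _ _ => (), ∅, fun _ _ _ => rfl, fun _ => by simp⟩

theorem density_empty : lowerDensity ∅ = 0 ∧ upperDensity ∅ = 0 := by
  have h0 : ∀ x, countBelow ∅ x = 0 := fun x => by
    induction x with
    | zero => exact Nat.le_zero.1 (countBelow_le _ _)
    | succ x ih => rw [countBelow_succ_of_notMem (Set.notMem_empty x), ih]
  have hup : upperDensity ∅ ≤ 0 :=
    upperDensity_le_of_eventually (Eventually.of_forall fun x => by simp [h0])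
  have h1 := lowerDensity_nonneg ∅
  have h2 := lowerDensity_le_upperDensity ∅
  exact ⟨by linarith, by linarith⟩

theorem theorem1p3 (k : ℕ) (hk : 2 ≤ k) :
    (∀ α β : ℚ, ((0 < α ∧ α ≤ β ∧ β < 1) ∨ (α = 0 ∧ β = 0) ∨ (α = 1 ∧ β = 1)) →
      ∃ S : Set ℕ, IsAutomaticSet hk S ∧ lowerDensity S = (α : ℝ) ∧ upperDensity S = (β : ℝ)) ∧
    (∀ (S : Set ℕ) (α β : ℝ), IsAutomaticSet hk S → lowerDensity S = α → upperDensity S = β →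
      (α = 0 ∧ β = 0) ∨ (α = 1 ∧ β = 1) ∨
      ((∃ p : ℚ, (p : ℝ) = α) ∧ (∃ q : ℚ, (q : ℝ) = β) ∧ 0 < α ∧ α ≤ β ∧ β < 1)) := by
  refine ⟨?_, ?_⟩
  · rintro α β (⟨hα, hαβ, hβ⟩ | ⟨rfl, rfl⟩ | ⟨rfl, rfl⟩)
    · obtain ⟨S, hS, h⟩ := exists_recognizable_of_density hk hα hαβ hβ
      exact ⟨S, hS.isAutomaticSet hk, h⟩
    · exact ⟨∅, (recognizable_empty k).isAutomaticSet hk, by simpa using density_empty⟩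
    · refine ⟨∅ᶜ, (recognizable_empty k).compl.isAutomaticSet hk, ?_, ?_⟩
      · rw [lowerDensity_eq, compl_compl, density_empty.2]; simp
      · rw [upperDensity_compl, density_empty.1]; simp
  · rintro S α β hS rfl rfl
    exact hS.recognizable.density_cases hk
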